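/- Let $P$ be a Markov transition kernel on a measurable space $\mathcal X$ that satisfies detailed balance $F(dx)P(x,dy)=F(dy)P(y,dx)$ with respect to a probability distribution $F$. Assume that $P$ is $\varphi$-irreducible for some nonzero $\sigma$-finite measure $\varphi$ and that $P$ is aperiodic (there are no $d\ge 2$ and pairwise disjoint measurable sets $D_0,\dots,D_{d-1}$ with $F(D_0)>0$ and $P(x,D_{j+1 \bmod d})=1$ for all $x\in D_j$ and all $j$). Let $X_0,X_1,X_2,\dots$ be a Markov chain with transition kernel $P$ and $X_0\sim F$. Let $p\ge 1$ and let $g:\mathcal X\to\mathbb R^p$ be square integrable with respect to $F$. Assume the following nontriviality: for every $v\in\mathbb R^p$ with $v\ne 0$ there is $t\ge 1$ with $\mathrm{cov}\{v^\top g(X_0),v^\top g(X_t)\}\neq 0$. For $t\in\mathbb N=\{0,1,2,\dots\}$ let $\gamma_t=\mathrm{cov}\{g(X_k),g(X_{k+t})\}\in\mathbb R^{p\times p}$, which does not depend on $k\in\mathbb N$, and for $i\in\mathbb N$ let $\Gamma_i=\gamma_{2i}+\gamma_{2i+1}$. Then: (i) $\Gamma_i$ is (symmetric) positive definite for all $i\in\mathbb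 N$; (ii) $\Gamma_i-\Gamma_{i+1}$ is positive definite for all $i\in\mathbb N$; (iii) $\lim_{i\to\infty}\Gamma_i=0$; (iv) writing $\xi_i$ for the smallest eigenvalue of $\Gamma_i$, the sequence $\{\xi_i\}_{i\in\mathbb N}$ is positive, strictly decreasing, and converges to $0$. -/

import Mathlib

open MeasureTheory ProbabilityTheory Filter
open scoped Topology Matrix ProbabilityTheory

namespace ReversibleChain

variable {S Ω : Type*} [MeasurableSpace S] [MeasurableSpace Ω]

/-- A Markov kernel `P` with invariant distribution `F` is aperiodic if there are no `d ≥ 2` and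
pairwise disjoint measurable sets `D 0, …, D (d - 1)`, the first of positive `F`-measure, through
which the chain moves cyclically with probability one. -/
def IsAperiodic (P : Kernel S S) (F : Measure S) : Prop :=
  ¬ ∃ d : ℕ, 2 ≤ d ∧ ∃ D : ZMod d → Set S,
    (∀ j, MeasurableSet (D j)) ∧
    Pairwise (Function.onFun Disjoint D) ∧
    (∀ j, ∀ x ∈ D j, P x (D (j + 1)) = 1) ∧
    0 < F (D 0)

/-- The sigma-algebra generated by `X 0, …, X n`. -/
abbrev history (X : ℕ → Ω → S) (n : ℕ) : MeasurableSpace Ω :=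
  ⨆ k ∈ Finset.range (n + 1), MeasurableSpace.comap (X k) inferInstance

/-- Under the probability measure `Pr`, the process `X 0, X 1, …` is a Markov chain with
transition kernel `P` and initial distribution `F`. -/
structure IsMarkovChain (Pr : Measure Ω) (X : ℕ → Ω → S) (P : Kernel S S) (F : Measure S) :
    Prop where
  measurable : ∀ n, Measurable (X n)
  initial : Pr.map (X 0) = F
  markov : ∀ (n : ℕ) (B : Set S), MeasurableSet B →
    Pr⟦X (n + 1) ⁻¹' B | history X n⟧ =ᵐ[Pr] fun ω => (P (X n ω)).real B

/-- The matrix `cov {g(X_k), g(X_l)}`. -/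
noncomputable def crossCov {p : ℕ} (Pr : Measure Ω) (X : ℕ → Ω → S) (g : S → Fin p → ℝ)
    (k l : ℕ) : Matrix (Fin p) (Fin p) ℝ :=
  Matrix.of fun a b => cov[fun ω => g (X k ω) a, fun ω => g (X l ω) b; Pr]

/-- The lag `t` autocovariance `γ_t`, computed from time `0`; for a stationary chain it equals
`cov {g(X_k), g(X_{k+t})}` for every `k`. -/
noncomputable def autocov {p : ℕ} (Pr : Measure Ω) (X : ℕ → Ω → S) (g : S → Fin p → ℝ)
    (t : ℕ) : Matrix (Fin p) (Fin p) ℝ :=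
  crossCov Pr X g 0 t

/-- The sum of an adjacent pair of autocovariances, `Γ_i = γ_{2i} + γ_{2i+1}`. -/
noncomputable def pairSum {p : ℕ} (Pr : Measure Ω) (X : ℕ → Ω → S) (g : S → Fin p → ℝ)
    (i : ℕ) : Matrix (Fin p) (Fin p) ℝ :=
  autocov Pr X g (2 * i) + autocov Pr X g (2 * i + 1)

/-- `c` is the smallest (real) eigenvalue of `A`. -/
def IsSmallestEigenvalue {p : ℕ} (A : Matrix (Fin p) (Fin p) ℝ) (c : ℝ) : Prop :=
  IsLeast {r : ℝ | Module.End.HasEigenvalue (Matrix.toLin' A) r} c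

end ReversibleChain

/-! Let `T` be the Markov operator of `P` on `L²(F)` and `h` the centred version of `v ⬝ᵥ g`. The
Markov property and stationarity give `cov{v ⬝ᵥ g(X_k), v ⬝ᵥ g(X_{k+t})} = ⟪h, T ^ t h⟫`
(`covariance_chain`), so everything reduces to a contraction `T`, symmetric by detailed balance.

Put `u = T ^ i h` and `w = u + T u`. By symmetry the quadratic form of `Γ_i` at `v` is `⟪u, u⟫ + ⟪u,
T u⟫ ≥ ‖u + T u‖² / 2`, and that of `Γ_i - Γ_{i+1}` is `⟪w, w⟫ - ⟪w, T w⟫ ≥ ‖w - T w‖² / 2`. These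
are positive once `u ≠ 0`, `-1` is not an eigenvalue and `1` has only constant eigenfunctions.
Nontriviality gives `T h ≠ 0`, hence `u ≠ 0` (`pow_apply_ne_zero`).

If `T f = ± f`, equality in the contraction bound forces `f(X_0) = ± f(X_1)` almost surely. With the
plus sign the level sets of `f` are closed under the chain, so irreducibility makes `f` constant;
with the minus sign the chain alternates between `{f > 0}` and `{f < 0}`, so aperiodicity makes `f`
vanish.

The same two facts give `T ^ n h → 0` (`tendsto_pow_apply_zero`), hence `Γ_i → 0`, without the
spectral theorem. The eigenvalue claims follow from the Rayleigh quotient. -/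

namespace ReversibleChain

/-! ### Symmetric contractions of a Hilbert space -/

section SymmetricContraction

open scoped InnerProductSpace

variable {E : Type*} [NormedAddCommGroup E] [InnerProductSpace ℝ E] {T : E →L[ℝ] E}

lemma inner_pow_left (hT : ∀ x y, ⟪T x, y⟫_ℝ = ⟪x, T y⟫_ℝ) (n : ℕ) (x y : E) :
    ⟪(T ^ n) x, y⟫_ℝ = ⟪x, (T ^ n) y⟫_ℝ := by
  induction n generalizing x y with
  | zero => simp
  | succ n ih => rw [pow_succ', mul_apply_eq_comp, hT, ih, ← mul_apply_eq_comp,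
      ← pow_succ, pow_succ']

lemma inner_pow_pow (hT : ∀ x y, ⟪T x, y⟫_ℝ = ⟪x, T y⟫_ℝ) (m n : ℕ) (x y : E) :
    ⟪(T ^ m) x, (T ^ n) y⟫_ℝ = ⟪x, (T ^ (m + n)) y⟫_ℝ := by
  rw [inner_pow_left hT, pow_add, mul_apply_eq_comp]

lemma norm_add_map_sq_le (hc : ∀ x, ‖T x‖ ≤ ‖x‖) (x : E) :
    ‖x + T x‖ ^ 2 ≤ 2 * (⟪x, x⟫_ℝ + ⟪x, T x⟫_ℝ) := by
  rw [norm_add_sq_real, real_inner_self_eq_norm_sq]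
  have := pow_le_pow_left₀ (norm_nonneg _) (hc x) 2
  linarith

lemma norm_sub_map_sq_le (hc : ∀ x, ‖T x‖ ≤ ‖x‖) (x : E) :
    ‖x - T x‖ ^ 2 ≤ 2 * (⟪x, x⟫_ℝ - ⟪x, T x⟫_ℝ) := by
  rw [norm_sub_sq_real, real_inner_self_eq_norm_sq]
  have := pow_le_pow_left₀ (norm_nonneg _) (hc x) 2
  linarith

lemma inner_self_add_map_pos (hc : ∀ x, ‖T x‖ ≤ ‖x‖) (hneg : ∀ x, T x = -x → x = 0)
    {x : E} (hx : x ≠ 0) : 0 < ⟪x, x⟫_ℝ + ⟪x, T x⟫_ℝ := by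
  have h : x + T x ≠ 0 := fun h ↦ hx (hneg x (eq_neg_of_add_eq_zero_right h))
  have := norm_add_map_sq_le hc x
  have : 0 < ‖x + T x‖ ^ 2 := by positivity
  linarith

/-- The kernel of a symmetric operator does not grow under powers: `‖T ^ (k+1) x‖² = ⟪T ^ k x, T ^
(k+2) x⟫`, so `T ^ (k+2) x = 0` already forces `T ^ (k+1) x = 0`. -/
lemma pow_apply_ne_zero (hT : ∀ x y, ⟪T x, y⟫_ℝ = ⟪x, T y⟫_ℝ) {x : E} (hx : T x ≠ 0) (n : ℕ) :
    (T ^ n) x ≠ 0 := by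
  have key : ∀ k, (T ^ (k + 1)) x ≠ 0 := by
    intro k
    induction k with
    | zero => simpa using hx
    | succ k ih =>
      intro h
      apply ih
      rw [← inner_self_eq_zero (𝕜 := ℝ), inner_pow_pow hT,
        show k + 1 + (k + 1) = k + (k + 1 + 1) by ring, ← inner_pow_pow hT, h, inner_zero_right]
  intro h
  exact key n (by rw [pow_succ', mul_apply_eq_comp, h, map_zero])

lemma inner_pow_pair (hT : ∀ x y, ⟪T x, y⟫_ℝ = ⟪x, T y⟫_ℝ) (x : E) (i : ℕ) :
    ⟪x, (T ^ (2 * i)) x⟫_ℝ + ⟪x, (T ^ (2 * i + 1)) x⟫_ℝ =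
      ⟪(T ^ i) x, (T ^ i) x⟫_ℝ + ⟪(T ^ i) x, T ((T ^ i) x)⟫_ℝ := by
  rw [← mul_apply_eq_comp T, ← pow_succ', inner_pow_pow hT, inner_pow_pow hT, two_mul,
    add_assoc]

lemma inner_pow_pair_pos (hT : ∀ x y, ⟪T x, y⟫_ℝ = ⟪x, T y⟫_ℝ) (hc : ∀ x, ‖T x‖ ≤ ‖x‖)
    (hneg : ∀ x, T x = -x → x = 0) {x : E} (hx : T x ≠ 0) (i : ℕ) :
    0 < ⟪x, (T ^ (2 * i)) x⟫_ℝ + ⟪x, (T ^ (2 * i + 1)) x⟫_ℝ := by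
  rw [inner_pow_pair hT]
  exact inner_self_add_map_pos hc hneg (pow_apply_ne_zero hT hx i)

lemma inner_pow_eq_of_fixed (hT : ∀ x y, ⟪T x, y⟫_ℝ = ⟪x, T y⟫_ℝ) {e : E} (he : T e = e)
    (n : ℕ) (x : E) : ⟪e, (T ^ n) x⟫_ℝ = ⟪e, x⟫_ℝ := by
  induction n with
  | zero => simp
  | succ n ih => rw [pow_succ', mul_apply_eq_comp, ← hT, he, ih]

/-- With `h = T ^ i x` and `k = h + T h`, the difference telescopes to `⟪k, k⟫ - ⟪k, T k⟫ ≥ ‖k - T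
k‖² / 2`. Here `k ≠ 0` because `-1` is not an eigenvalue, and `T k ≠ k` because `k` is orthogonal to
`e`. -/
lemma inner_pow_pair_sub_pos (hT : ∀ x y, ⟪T x, y⟫_ℝ = ⟪x, T y⟫_ℝ) (hc : ∀ x, ‖T x‖ ≤ ‖x‖)
    {e : E} (he : T e = e) (hfix : ∀ x, ⟪e, x⟫_ℝ = 0 → T x = x → x = 0)
    (hneg : ∀ x, T x = -x → x = 0) {x : E} (hex : ⟪e, x⟫_ℝ = 0) (hx : T x ≠ 0) (i : ℕ) :
    0 < (⟪x, (T ^ (2 * i)) x⟫_ℝ + ⟪x, (T ^ (2 * i + 1)) x⟫_ℝ) -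
      (⟪x, (T ^ (2 * (i + 1))) x⟫_ℝ + ⟪x, (T ^ (2 * (i + 1) + 1)) x⟫_ℝ) := by
  rw [inner_pow_pair hT, inner_pow_pair hT, pow_succ', mul_apply_eq_comp]
  set h := (T ^ i) x with h_def
  have h0 : h ≠ 0 := pow_apply_ne_zero hT hx i
  have heh : ⟪e, h⟫_ℝ = 0 := by rw [h_def, inner_pow_eq_of_fixed hT he, hex]
  have hek : ⟪e, h + T h⟫_ℝ = 0 := by rw [inner_add_right, ← hT, he, heh, add_zero]
  have hk : h + T h ≠ 0 := fun h' ↦ h0 (hneg h (eq_neg_of_add_eq_zero_right h'))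
  have hk' : (h + T h) - T (h + T h) ≠ 0 := fun h' ↦ hk (hfix _ hek (sub_eq_zero.1 h').symm)
  have h1 := norm_sub_map_sq_le hc (h + T h)
  have h2 : 0 < ‖(h + T h) - T (h + T h)‖ ^ 2 := by positivity
  have h3 : ⟪h + T h, h + T h⟫_ℝ - ⟪h + T h, T (h + T h)⟫_ℝ =
      ⟪h, h⟫_ℝ + ⟪h, T h⟫_ℝ - (⟪T h, T h⟫_ℝ + ⟪T h, T (T h)⟫_ℝ) := by
    simp only [map_add, inner_add_left, inner_add_right]
    rw [hT h h, hT h (T h)]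
    ring
  linarith

/-- The orbits of a symmetric contraction with no eigenvectors for the eigenvalues `1` and `-1`
(apart from those along `e`) tend to zero. -/
lemma tendsto_pow_apply_zero [CompleteSpace E]
    (hT : ∀ x y, ⟪T x, y⟫_ℝ = ⟪x, T y⟫_ℝ) (hc : ∀ x, ‖T x‖ ≤ ‖x‖)
    {e : E} (he : T e = e) (hfix : ∀ x, ⟪e, x⟫_ℝ = 0 → T x = x → x = 0)
    (hneg : ∀ x, T x = -x → x = 0) {x : E} (hex : ⟪e, x⟫_ℝ = 0) :
    Tendsto (fun n ↦ (T ^ n) x) atTop (𝓝 0) := by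
  let a : ℕ → ℝ := fun n ↦ ‖(T ^ n) x‖ ^ 2
  have ha : Antitone a := antitone_nat_of_succ_le fun n ↦ by
    simp only [a, pow_succ' T, mul_apply_eq_comp]
    exact pow_le_pow_left₀ (norm_nonneg _) (hc _) 2
  have hnorm : Antitone fun n ↦ ‖(T ^ n) x‖ := antitone_nat_of_succ_le fun n ↦ by
    simp only [pow_succ' T, mul_apply_eq_comp]
    exact hc _
  have hbdd : BddBelow (Set.range a) := ⟨0, by rintro _ ⟨n, rfl⟩; positivity⟩
  have hlim := tendsto_atTop_ciInf ha hbdd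
  set l := ⨅ n, a n
  -- The inner product of two even iterates depends only on `m + n`; even exponents are needed to
  -- split `2 * m + 2 * n` into equal halves.
  have hinner : ∀ m n, ⟪(T ^ (2 * m)) x, (T ^ (2 * n)) x⟫_ℝ = a (m + n) := by
    intro m n
    simp only [a]
    rw [← real_inner_self_eq_norm_sq, inner_pow_pow hT, inner_pow_pow hT]
    congr 3
    ring
  have hdist : ∀ m n, ‖(T ^ (2 * m)) x - (T ^ (2 * n)) x‖ ^ 2
      = a (m + m) - 2 * a (m + n) + a (n + n) := by
    intro m n
    rw [norm_sub_sq_real, hinner, ← real_inner_self_eq_norm_sq, ← real_inner_self_eq_norm_sq,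
      hinner, hinner]
  have hcauchy : CauchySeq fun n ↦ (T ^ (2 * n)) x := by
    rw [Metric.cauchySeq_iff]
    intro ε hε
    -- By `hdist` and monotonicity, the squared distance is at most `2 * (a N - l)`, hence the
    -- margin `ε ^ 2 / 2`.
    obtain ⟨N, hN⟩ := (hlim.eventually (gt_mem_nhds
      (show l < l + ε ^ 2 / 2 by linarith [sq_pos_of_pos hε]))).exists
    refine ⟨N, fun m hm n hn ↦ ?_⟩
    rw [dist_eq_norm]
    refine lt_of_pow_lt_pow_left₀ 2 hε.le ?_
    rw [hdist]
    have h1 := ha (show N ≤ m + m by omega)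
    have h2 := ha (show N ≤ n + n by omega)
    have h3 : l ≤ a (m + n) := ciInf_le hbdd _
    linarith
  obtain ⟨z, hz⟩ := cauchySeq_tendsto_of_complete hcauchy
  have hz2 : T (T z) = z := by
    have h1 : Tendsto (fun n ↦ T (T ((T ^ (2 * n)) x))) atTop (𝓝 (T (T z))) :=
      ((T.continuous.comp T.continuous).tendsto z).comp hz
    have h2 : Tendsto (fun n ↦ (T ^ (2 * (n + 1))) x) atTop (𝓝 z) :=
      hz.comp (tendsto_add_atTop_nat 1)
    refine tendsto_nhds_unique h1 (h2.congr fun n ↦ ?_)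
    rw [mul_add, mul_one, pow_succ', pow_succ']
    rfl
  have hez : ⟪e, z⟫_ℝ = 0 := by
    have h1 : Tendsto (fun n ↦ ⟪e, (T ^ (2 * n)) x⟫_ℝ) atTop (𝓝 ⟪e, z⟫_ℝ) :=
      tendsto_const_nhds.inner hz
    simp only [inner_pow_eq_of_fixed hT he, hex] at h1
    exact (tendsto_const_nhds_iff.1 h1).symm
  -- Since `T² z = z`, the vector `z + T z` is fixed by `T` and orthogonal to `e`, so it vanishes;
  -- then `T z = -z`.
  have hz0 : z = 0 := by
    refine hneg z (eq_neg_of_add_eq_zero_right (hfix _ ?_ ?_))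
    · rw [inner_add_right, ← hT, he, hez, add_zero]
    · rw [map_add, hz2, add_comm]
  subst hz0
  rw [tendsto_zero_iff_norm_tendsto_zero] at hz ⊢
  rw [Metric.tendsto_atTop] at hz ⊢
  intro ε hε
  obtain ⟨N, hN⟩ := hz ε hε
  -- Norms decrease along the whole orbit, so smallness at one even exponent controls all later
  -- ones, odd ones included.
  refine ⟨2 * N, fun n hn ↦ lt_of_le_of_lt ?_ (hN N le_rfl)⟩
  simpa using hnorm hn

end SymmetricContraction

end ReversibleChain

namespace ReversibleChain

/-! ### Absorbing sets, irreducibility and periodicity -/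

section AbsorbingSets

variable {S : Type*} [MeasurableSpace S] {F : Measure S} {P : Kernel S S}

lemma ae_kernel_apply_eq_zero (h_inv : P.Invariant F) {N : Set S} (hN : MeasurableSet N)
    (hF : F N = 0) : ∀ᵐ x ∂F, P x N = 0 := by
  have h : ∫⁻ x, P x N ∂F = 0 := by
    rw [← Measure.bind_apply hN P.aemeasurable, h_inv.def, hF]
  rwa [lintegral_eq_zero_iff (P.measurable_coe hN)] at h

/-- Every null set lies in a null set which the chain does not enter from outside. -/
lemma exists_null_superset (h_inv : P.Invariant F) {N : Set S} (hF : F N = 0) :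
    ∃ M, N ⊆ M ∧ MeasurableSet M ∧ F M = 0 ∧ ∀ x ∉ M, P x M = 0 := by
  -- Keep adjoining the points that enter the current set with positive probability; by invariance
  -- each adjoined set is null.
  let s : ℕ → Set S := fun n ↦
    Nat.rec (toMeasurable F N) (fun _ A ↦ A ∪ {x | P x A ≠ 0}) n
  have s_succ : ∀ n, s (n + 1) = s n ∪ {x | P x (s n) ≠ 0} := fun n ↦ rfl
  have hs : ∀ n, MeasurableSet (s n) ∧ F (s n) = 0 := by
    intro n
    induction n with
    | zero => exact ⟨measurableSet_toMeasurable _ _, by simp [s, measure_toMeasurable, hF]⟩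
    | succ n ih =>
      rw [s_succ]
      refine ⟨ih.1.union ?_, measure_union_null ih.2 ?_⟩
      · exact (P.measurable_coe ih.1 (measurableSet_singleton 0)).compl
      · exact ae_kernel_apply_eq_zero h_inv ih.1 ih.2
  refine ⟨⋃ n, s n, (subset_toMeasurable F N).trans (Set.subset_iUnion s 0),
    .iUnion fun n ↦ (hs n).1, measure_iUnion_null fun n ↦ (hs n).2, fun x hx ↦ ?_⟩
  refine measure_iUnion_null fun n ↦ ?_
  by_contra h
  exact hx (Set.mem_iUnion.2 ⟨n + 1, by rw [s_succ]; exact Or.inr h⟩)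

lemma pow_apply_eq_zero_of_absorbing {A : Set S} (hA : MeasurableSet A)
    (h : ∀ x ∉ A, P x A = 0) (n : ℕ) : ∀ x ∉ A, (P ^ n) x A = 0 := by
  induction n with
  | zero =>
    intro x hx
    simp [show (1 : Kernel S S) = Kernel.id from rfl, Kernel.id_apply, hA, hx]
  | succ n ih =>
    intro x hx
    rw [Kernel.pow_succ_apply_eq_lintegral _ _ _ hA,
      lintegral_eq_zero_iff (Kernel.measurable_coe _ hA)]
    filter_upwards [measure_eq_zero_iff_ae_notMem.1 (ih x hx)] with y hy using h y hy

/-- If `A` is almost surely not entered from outside, then `A` is `φ`-null or has full measure. -/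
lemma measure_eq_zero_or_of_absorbing (h_inv : P.Invariant F) {φ : Measure S}
    (h_irr : Kernel.IsIrreducible φ P) {A : Set S} (hA : MeasurableSet A)
    (h : ∀ᵐ x ∂F, x ∉ A → P x A = 0) : φ A = 0 ∨ F Aᶜ = 0 := by
  -- Irreducibility speaks of every starting point, so the almost sure hypothesis is first made to
  -- hold everywhere off a null set `M` that is itself not entered from outside.
  obtain ⟨M, hNM, hM, hFM, habs⟩ := exists_null_superset h_inv (ae_iff.1 h)
  have hM' : ∀ x ∉ A ∪ M, P x (A ∪ M) = 0 := by
    intro x hx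
    rw [Set.mem_union, not_or] at hx
    refine measure_union_null ?_ (habs x hx.2)
    by_contra h'
    exact hx.2 (hNM fun h'' ↦ h' (h'' hx.1))
  by_contra! hcon
  have hpos : F (A ∪ M)ᶜ ≠ 0 := by
    intro h0
    refine hcon.2 (measure_mono_null ?_ (measure_union_null h0 hFM))
    intro x hx
    by_cases hxM : x ∈ M
    · exact Or.inr hxM
    · exact Or.inl fun h' ↦ h'.elim hx hxM
  obtain ⟨x, hx⟩ := nonempty_of_measure_ne_zero hpos
  obtain ⟨n, hn⟩ := h_irr.irreducible hA (pos_iff_ne_zero.2 hcon.1) x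
  exact hn.ne' (measure_mono_null Set.subset_union_left
    (pow_apply_eq_zero_of_absorbing (hA.union hM) hM' n x hx))

/-- Both `A` and its complement are closed under the chain, and the nonzero measure `φ` cannot
vanish on both. -/
lemma measure_eq_zero_or_compl_of_invariant_set (h_inv : P.Invariant F)
    {φ : Measure S} (h_phi : φ ≠ 0) (h_irr : Kernel.IsIrreducible φ P) {A : Set S} (hA : MeasurableSet A)
    (h1 : ∀ᵐ x ∂F, x ∉ A → P x A = 0) (h2 : ∀ᵐ x ∂F, x ∈ A → P x Aᶜ = 0) :
    F A = 0 ∨ F Aᶜ = 0 := by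
  rcases measure_eq_zero_or_of_absorbing h_inv h_irr hA h1 with h | h
  · rcases measure_eq_zero_or_of_absorbing h_inv h_irr hA.compl
      (by simpa only [Set.notMem_compl_iff] using h2) with h' | h'
    · refine absurd ?_ h_phi
      rw [← Measure.measure_univ_eq_zero, ← Set.union_compl_self A]
      exact measure_union_null h h'
    · exact Or.inl (by rwa [compl_compl] at h')
  · exact Or.inr h

/-- A function which is almost surely preserved by an irreducible kernel is constant. -/
lemma exists_ae_eq_const_of_ae_preserved [SFinite F] [IsSFiniteKernel P] (h_inv : P.Invariant F)
    {φ : Measure S} (h_phi : φ ≠ 0) (h_irr : Kernel.IsIrreducible φ P) {f : S → ℝ}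
    (hf : Measurable f) (h : ∀ᵐ q ∂(F ⊗ₘ P), f q.1 = f q.2) : ∃ c, f =ᵐ[F] fun _ ↦ c := by
  have h' := Measure.ae_ae_of_ae_compProd h
  -- Countably many measurable sets separate the reals, so it is enough that every measurable
  -- preimage is null or conull.
  refine exists_eventuallyEq_const_of_forall_separating MeasurableSet fun U hU ↦ ?_
  have := measure_eq_zero_or_compl_of_invariant_set h_inv h_phi h_irr (hf hU) ?_ ?_
  · rcases this with h0 | h0
    · exact Or.inr (measure_eq_zero_iff_ae_notMem.1 h0)
    · exact Or.inl (by simpa using measure_eq_zero_iff_ae_notMem.1 h0)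
  · filter_upwards [h'] with x hx hxU
    refine measure_eq_zero_iff_ae_notMem.2 ?_
    filter_upwards [hx] with y hy
    simpa only [Set.mem_preimage, ← hy] using hxU
  · filter_upwards [h'] with x hx hxU
    refine measure_eq_zero_iff_ae_notMem.2 ?_
    filter_upwards [hx] with y hy
    simpa only [Set.mem_compl_iff, Set.mem_preimage, ← hy, not_not] using hxU

/-- Otherwise `A` and `B`, with a null set that is never entered from outside removed, form a cycle
of period two holding at every point, as `IsAperiodic` demands. -/
lemma measure_eq_zero_of_alternating [IsMarkovKernel P] (h_inv : P.Invariant F)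
    (h_aper : IsAperiodic P F) {A B : Set S} (hA : MeasurableSet A) (hB : MeasurableSet B)
    (hAB : Disjoint A B) (h1 : ∀ᵐ x ∂F, x ∈ A → P x Bᶜ = 0) (h2 : ∀ᵐ x ∂F, x ∈ B → P x Aᶜ = 0) :
    F A = 0 := by
  obtain ⟨M, hNM, hM, hFM, habs⟩ := exists_null_superset h_inv (ae_iff.1 (h1.and h2))
  by_contra hne
  refine h_aper ⟨2, le_rfl, (![A \ M, B \ M] : Fin 2 → Set S), ?_, ?_, ?_, ?_⟩
  · exact Fin.forall_fin_two.2 ⟨hA.diff hM, hB.diff hM⟩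
  · have hd : Disjoint (A \ M) (B \ M) := hAB.mono Set.sdiff_subset Set.sdiff_subset
    have hpair : ∀ i j : Fin 2, i ≠ j →
        Disjoint ((![A \ M, B \ M] : Fin 2 → Set S) i) ((![A \ M, B \ M] : Fin 2 → Set S) j) :=
      Fin.forall_fin_two.2 ⟨Fin.forall_fin_two.2 ⟨fun h ↦ absurd rfl h, fun _ ↦ hd⟩,
        Fin.forall_fin_two.2 ⟨fun _ ↦ hd.symm, fun h ↦ absurd rfl h⟩⟩
    exact fun i j ↦ hpair i j
  · have one_of : ∀ x (C : Set S), MeasurableSet C → x ∉ M → P x Cᶜ = 0 → P x (C \ M) = 1 := by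
      intro x C hC hx hC0
      rw [prob_compl_eq_zero_iff (hC.diff hM) |>.symm, Set.compl_sdiff]
      exact measure_union_null (habs x hx) hC0
    have key : ∀ x ∉ M, (x ∈ A → P x Bᶜ = 0) ∧ (x ∈ B → P x Aᶜ = 0) := by
      intro x hx
      by_contra h
      exact hx (hNM h)
    exact Fin.forall_fin_two.2 ⟨fun x hx ↦ one_of x B hB hx.2 ((key x hx.2).1 hx.1),
      fun x hx ↦ one_of x A hA hx.2 ((key x hx.2).2 hx.1)⟩
  · have hpos : 0 < F (A \ M) := pos_iff_ne_zero.2 (by rwa [measure_sdiff_null hFM])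
    exact hpos

/-- A function which almost surely changes sign under an aperiodic kernel vanishes. -/
lemma ae_eq_zero_of_ae_sign_change [SFinite F] [IsMarkovKernel P] (h_inv : P.Invariant F)
    (h_aper : IsAperiodic P F) {f : S → ℝ} (hf : Measurable f)
    (h : ∀ᵐ q ∂(F ⊗ₘ P), f q.1 = -f q.2) : f =ᵐ[F] 0 := by
  have h' := Measure.ae_ae_of_ae_compProd h
  have hpos : MeasurableSet {x | 0 < f x} := measurableSet_lt measurable_const hf
  have hneg : MeasurableSet {x | f x < 0} := measurableSet_lt hf measurable_const
  have hdisj : Disjoint {x | 0 < f x} {x | f x < 0} :=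
    Set.disjoint_left.2 fun x (hx : 0 < f x) hx' ↦ lt_asymm hx hx'
  have h1 : ∀ᵐ x ∂F, x ∈ {x | 0 < f x} → P x {x | f x < 0}ᶜ = 0 := by
    filter_upwards [h'] with x hx hxU
    refine measure_eq_zero_iff_ae_notMem.2 ?_
    filter_upwards [hx] with y hy
    simp only [Set.mem_ofPred_eq, Set.mem_compl_iff, not_not] at hxU ⊢
    linarith
  have h2 : ∀ᵐ x ∂F, x ∈ {x | f x < 0} → P x {x | 0 < f x}ᶜ = 0 := by
    filter_upwards [h'] with x hx hxU
    refine measure_eq_zero_iff_ae_notMem.2 ?_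
    filter_upwards [hx] with y hy
    simp only [Set.mem_ofPred_eq, Set.mem_compl_iff, not_not] at hxU ⊢
    linarith
  have e1 := measure_eq_zero_iff_ae_notMem.1
    (measure_eq_zero_of_alternating h_inv h_aper hpos hneg hdisj h1 h2)
  have e2 := measure_eq_zero_iff_ae_notMem.1
    (measure_eq_zero_of_alternating h_inv h_aper hneg hpos hdisj.symm h2 h1)
  filter_upwards [e1, e2] with x hx1 hx2
  simp only [not_lt] at hx1 hx2
  exact le_antisymm hx1 hx2

end AbsorbingSets

end ReversibleChain

namespace ReversibleChain

/-! ### The Markov operator on `L²(F)` -/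

section Operator

open scoped InnerProductSpace

variable {S : Type*} [MeasurableSpace S] {F : Measure S}

/-- Bounded operators on `L²` are determined by their values on indicators. -/
lemma continuousLinearMap_ext_indicator [IsFiniteMeasure F] {G : Type*} [NormedAddCommGroup G]
    [NormedSpace ℝ G] {A B : Lp ℝ 2 F →L[ℝ] G}
    (h : ∀ s (hs : MeasurableSet s), A (indicatorConstLp 2 hs (measure_ne_top F s) 1) =
      B (indicatorConstLp 2 hs (measure_ne_top F s) 1)) : A = B := by
  ext f
  refine Lp.induction ENNReal.ofNat_ne_top (motive := fun f ↦ A f = B f) ?_ ?_ ?_ f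
  · intro c s hs hμs
    rw [Lp.simpleFunc.coe_indicatorConst]
    have : (indicatorConstLp 2 hs hμs.ne c : Lp ℝ 2 F) =
        c • indicatorConstLp 2 hs (measure_ne_top F s) 1 := by
      rw [indicatorConstLp, indicatorConstLp, ← MemLp.toLp_const_smul]
      congr 1
      ext x
      by_cases hx : x ∈ s <;> simp [hx]
    rw [this, map_smul, map_smul, h]
  · intro f g hf hg _ h1 h2
    rw [map_add, map_add, h1, h2]
  · exact isClosed_eq A.continuous B.continuous

lemma eq_of_inner_indicatorConstLp [IsFiniteMeasure F] {f g : Lp ℝ 2 F}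
    (h : ∀ s (hs : MeasurableSet s), ⟪indicatorConstLp 2 hs (measure_ne_top F s) 1, f⟫_ℝ =
      ⟪indicatorConstLp 2 hs (measure_ne_top F s) 1, g⟫_ℝ) : f = g := by
  have h' : innerSL ℝ f = innerSL ℝ g := continuousLinearMap_ext_indicator fun s hs ↦ by
    rw [innerSL_apply_apply, innerSL_apply_apply, real_inner_comm, h, real_inner_comm]
  refine ext_inner_right ℝ fun v ↦ ?_
  rw [← innerSL_apply_apply, h', innerSL_apply_apply]

lemma inner_eq_integral_mul {α : Type*} [MeasurableSpace α] {μ : Measure α} (f g : Lp ℝ 2 μ) :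
    ⟪f, g⟫_ℝ = ∫ x, f x * g x ∂μ := by
  rw [L2.inner_def]
  refine integral_congr_ae (.of_forall fun x ↦ ?_)
  simp [mul_comm]

/-- Composition with a measure preserving map, as an isometry of `L²` spaces. -/
noncomputable def pullback {α β : Type*} [MeasurableSpace α] [MeasurableSpace β] {μ : Measure α}
    {ν : Measure β} {u : α → β} (hu : MeasurePreserving u μ ν) : Lp ℝ 2 ν →ₗᵢ[ℝ] Lp ℝ 2 μ :=
  Lp.compMeasurePreservingₗᵢ ℝ u hu

section Pullback

variable {α β : Type*} [MeasurableSpace α] [MeasurableSpace β] {μ : Measure α}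
  {ν : Measure β} {u : α → β}

lemma coeFn_pullback (hu : MeasurePreserving u μ ν) (f : Lp ℝ 2 ν) :
    pullback hu f =ᵐ[μ] fun x ↦ f (u x) :=
  Lp.coeFn_compMeasurePreserving f hu

lemma pullback_toLp (hu : MeasurePreserving u μ ν) {f : β → ℝ} (hf : MemLp f 2 ν) :
    pullback hu (hf.toLp f) = (hf.comp_measurePreserving hu).toLp _ := rfl

lemma pullback_indicatorConstLp [IsFiniteMeasure μ] [IsFiniteMeasure ν]
    (hu : MeasurePreserving u μ ν) {s : Set β} (hs : MeasurableSet s) :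
    pullback hu (indicatorConstLp 2 hs (measure_ne_top ν s) 1) =
      indicatorConstLp 2 (hu.measurable hs) (measure_ne_top μ _) 1 :=
  Lp.indicatorConstLp_compMeasurePreserving hs (measure_ne_top ν s) 1 hu

end Pullback

variable [IsProbabilityMeasure F] {P : Kernel S S} [IsMarkovKernel P]

lemma measurePreserving_fst (F : Measure S) [IsProbabilityMeasure F] (P : Kernel S S)
    [IsMarkovKernel P] : MeasurePreserving Prod.fst (F ⊗ₘ P) F :=
  ⟨measurable_fst, Measure.fst_compProd F P⟩

lemma measurePreserving_snd (h_inv : P.Invariant F) : MeasurePreserving Prod.snd (F ⊗ₘ P) F :=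
  ⟨measurable_snd, (Measure.snd_compProd F P).trans h_inv⟩

/-- The Markov operator of `P` on `L²(F)`, as a compression of the coordinate maps. -/
noncomputable def markovOp (h_inv : P.Invariant F) : Lp ℝ 2 F →L[ℝ] Lp ℝ 2 F :=
  (ContinuousLinearMap.adjoint (pullback (measurePreserving_fst F P)).toContinuousLinearMap) ∘L
    (pullback (measurePreserving_snd h_inv)).toContinuousLinearMap

lemma inner_markovOp (h_inv : P.Invariant F) (f g : Lp ℝ 2 F) :
    ⟪f, markovOp h_inv g⟫_ℝ =
      ⟪pullback (measurePreserving_fst F P) f, pullback (measurePreserving_snd h_inv) g⟫_ℝ := by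
  rw [markovOp, ContinuousLinearMap.comp_apply, ContinuousLinearMap.adjoint_inner_right]
  rfl

lemma norm_markovOp_le (h_inv : P.Invariant F) (f : Lp ℝ 2 F) : ‖markovOp h_inv f‖ ≤ ‖f‖ := by
  have h : ‖markovOp h_inv f‖ * ‖markovOp h_inv f‖ ≤ ‖markovOp h_inv f‖ * ‖f‖ := by
    rw [← real_inner_self_eq_norm_mul_norm, inner_markovOp]
    refine (real_inner_le_norm _ _).trans_eq ?_
    rw [LinearIsometry.norm_map, LinearIsometry.norm_map]
  rcases (norm_nonneg (markovOp h_inv f)).eq_or_lt with h0 | h0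
  · rw [← h0]
    exact norm_nonneg f
  · exact le_of_mul_le_mul_left h h0

lemma map_swap_compProd (h_rev : P.IsReversible F) : (F ⊗ₘ P).map Prod.swap = F ⊗ₘ P := by
  have : IsProbabilityMeasure ((F ⊗ₘ P).map Prod.swap) :=
    Measure.isProbabilityMeasure_map measurable_swap.aemeasurable
  refine Measure.ext_prod fun {s t} hs ht ↦ ?_
  rw [Measure.map_apply measurable_swap (hs.prod ht), Set.preimage_swap_prod,
    Measure.compProd_apply_prod ht hs, Measure.compProd_apply_prod hs ht, h_rev ht hs]

lemma inner_pullback (h_inv : P.Invariant F) (f g : Lp ℝ 2 F) :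
    ⟪pullback (measurePreserving_fst F P) f, pullback (measurePreserving_snd h_inv) g⟫_ℝ =
      ∫ q, f q.1 * g q.2 ∂(F ⊗ₘ P) := by
  rw [inner_eq_integral_mul]
  refine integral_congr_ae ?_
  filter_upwards [coeFn_pullback (measurePreserving_fst F P) f,
    coeFn_pullback (measurePreserving_snd h_inv) g] with q h1 h2
  rw [h1, h2]

/-- Detailed balance says that the joint law `F ⊗ₘ P` of two consecutive states is invariant under
swapping coordinates. -/
lemma markovOp_symm (h_rev : P.IsReversible F) (f g : Lp ℝ 2 F) :
    ⟪markovOp h_rev.invariant f, g⟫_ℝ = ⟪f, markovOp h_rev.invariant g⟫_ℝ := by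
  rw [real_inner_comm, inner_markovOp h_rev.invariant, inner_markovOp h_rev.invariant,
    inner_pullback h_rev.invariant, inner_pullback h_rev.invariant]
  have hswap : MeasurePreserving (MeasurableEquiv.prodComm : S × S ≃ᵐ S × S) (F ⊗ₘ P) (F ⊗ₘ P) :=
    ⟨measurable_swap, map_swap_compProd h_rev⟩
  rw [← hswap.integral_comp' fun q : S × S ↦ f q.1 * g q.2]
  exact integral_congr_ae (.of_forall fun q ↦ mul_comm _ _)

/-- The constant function `1` in `L²(F)`. -/
noncomputable def oneLp (F : Measure S) [IsProbabilityMeasure F] : Lp ℝ 2 F :=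
  indicatorConstLp 2 MeasurableSet.univ (measure_ne_top F _) 1

lemma inner_oneLp (f : Lp ℝ 2 F) : ⟪oneLp F, f⟫_ℝ = ∫ x, f x ∂F := by
  rw [oneLp, L2.inner_indicatorConstLp_one, setIntegral_univ]

lemma markovOp_oneLp (h_inv : P.Invariant F) : markovOp h_inv (oneLp F) = oneLp F := by
  refine ext_inner_left ℝ fun f ↦ ?_
  rw [inner_markovOp, ← (pullback (measurePreserving_fst F P)).inner_map_map f]
  simp only [oneLp, pullback_indicatorConstLp, Set.preimage_univ]

/-- Both pullbacks have norm `‖f‖` and their inner product is `⟪f, T f⟫ = ‖f‖²`, so the squared norm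
of their difference is zero. -/
lemma pullback_eq_of_markovOp_eq {h_inv : P.Invariant F} {f : Lp ℝ 2 F}
    (h : markovOp h_inv f = f) :
    pullback (measurePreserving_fst F P) f = pullback (measurePreserving_snd h_inv) f := by
  rw [← sub_eq_zero, ← norm_eq_zero, ← sq_eq_zero_iff, norm_sub_sq_real, ← inner_markovOp h_inv, h,
    LinearIsometry.norm_map, LinearIsometry.norm_map, real_inner_self_eq_norm_sq]
  ring

lemma pullback_eq_neg_of_markovOp_eq_neg {h_inv : P.Invariant F} {f : Lp ℝ 2 F}
    (h : markovOp h_inv f = -f) :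
    pullback (measurePreserving_fst F P) f = -pullback (measurePreserving_snd h_inv) f := by
  rw [← sub_eq_zero, sub_neg_eq_add, ← norm_eq_zero, ← sq_eq_zero_iff, norm_add_sq_real,
    ← inner_markovOp h_inv, h, LinearIsometry.norm_map, LinearIsometry.norm_map, inner_neg_right,
    real_inner_self_eq_norm_sq]
  ring

lemma eq_zero_of_markovOp_eq {h_inv : P.Invariant F} {φ : Measure S} (h_phi : φ ≠ 0)
    (h_irr : Kernel.IsIrreducible φ P) {f : Lp ℝ 2 F} (hf : ⟪oneLp F, f⟫_ℝ = 0)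
    (h : markovOp h_inv f = f) : f = 0 := by
  have hae : ∀ᵐ q ∂(F ⊗ₘ P), f q.1 = f q.2 := by
    have h1 := coeFn_pullback (measurePreserving_fst F P) f
    rw [pullback_eq_of_markovOp_eq h] at h1
    filter_upwards [h1, coeFn_pullback (measurePreserving_snd h_inv) f] with q h1 h2
    rw [← h1, h2]
  obtain ⟨c, hc⟩ := exists_ae_eq_const_of_ae_preserved h_inv h_phi h_irr
    (Lp.stronglyMeasurable f).measurable hae
  rw [inner_oneLp, integral_congr_ae hc] at hf
  have hc0 : c = 0 := by simpa using hf
  rw [Lp.eq_zero_iff_ae_eq_zero]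
  filter_upwards [hc] with x hx
  rw [hx, hc0, Pi.zero_apply]

lemma eq_zero_of_markovOp_eq_neg {h_inv : P.Invariant F} (h_aper : IsAperiodic P F)
    {f : Lp ℝ 2 F} (h : markovOp h_inv f = -f) : f = 0 := by
  rw [Lp.eq_zero_iff_ae_eq_zero]
  refine ae_eq_zero_of_ae_sign_change h_inv h_aper (Lp.stronglyMeasurable f).measurable ?_
  have h1 := coeFn_pullback (measurePreserving_fst F P) f
  rw [pullback_eq_neg_of_markovOp_eq_neg h] at h1
  filter_upwards [h1, coeFn_pullback (measurePreserving_snd h_inv) f,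
    Lp.coeFn_neg (pullback (measurePreserving_snd h_inv) f)] with q h1 h2 h3
  rw [← h1, h3, Pi.neg_apply, h2]

/-- The Markov operator maps the indicator of `B` to `x ↦ P x B`. -/
lemma markovOp_indicatorConstLp (h_inv : P.Invariant F) {B : Set S} (hB : MeasurableSet B) :
    markovOp h_inv (indicatorConstLp 2 hB (measure_ne_top F B) 1) =ᵐ[F] fun x ↦ (P x).real B := by
  have hmeas : Measurable fun x ↦ (P x).real B := (P.measurable_coe hB).ennreal_toReal
  have hint : Integrable (fun x ↦ (P x).real B) F :=
    .of_bound hmeas.aestronglyMeasurable 1 (.of_forall fun x ↦ by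
      rw [Real.norm_of_nonneg measureReal_nonneg]
      exact measureReal_le_one)
  refine Integrable.ae_eq_of_forall_setIntegral_eq _ _
    ((Lp.memLp _).integrable (by norm_num)) hint fun A hA _ ↦ ?_
  rw [← L2.inner_indicatorConstLp_one (𝕜 := ℝ) hA (measure_ne_top F A), inner_markovOp,
    pullback_indicatorConstLp, pullback_indicatorConstLp,
    L2.inner_indicatorConstLp_one_indicatorConstLp_one, ← Set.prod_eq, RCLike.ofReal_real_eq_id, id,
    measureReal_def, Measure.compProd_apply_prod hA hB]
  exact (integral_toReal (P.measurable_coe hB).aemeasurable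
    (.of_forall fun x ↦ measure_lt_top _ _)).symm

end Operator

end ReversibleChain

namespace ReversibleChain

/-! ### Covariances of the chain as inner products -/

section Chain

open scoped InnerProductSpace

lemma comap_le_history {S Ω : Type*} [MeasurableSpace S] {X : ℕ → Ω → S} {k n : ℕ} (hk : k ≤ n) :
    MeasurableSpace.comap (X k) inferInstance ≤ history X n :=
  le_iSup₂_of_le k (Finset.mem_range.2 (Nat.lt_succ_of_le hk)) le_rfl

variable {S Ω : Type*} [MeasurableSpace S] [MeasurableSpace Ω] {F : Measure S}
  {P : Kernel S S} {Pr : Measure Ω} {X : ℕ → Ω → S}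

lemma history_le (h_chain : IsMarkovChain Pr X P F) (n : ℕ) :
    history X n ≤ (inferInstance : MeasurableSpace Ω) :=
  iSup₂_le fun k _ ↦ (h_chain.measurable k).comap_le

variable [IsProbabilityMeasure Pr]

/-- The integrated Markov property. -/
lemma measureReal_inter_preimage (h_chain : IsMarkovChain Pr X P F) {k n : ℕ} (hk : k ≤ n)
    {A B : Set S} (hA : MeasurableSet A) (hB : MeasurableSet B) :
    Pr.real (X k ⁻¹' A ∩ X (n + 1) ⁻¹' B) = ∫ ω in X k ⁻¹' A, (P (X n ω)).real B ∂Pr := by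
  have hA' : MeasurableSet[history X n] (X k ⁻¹' A) := comap_le_history hk _ ⟨A, hA, rfl⟩
  have hB' : MeasurableSet (X (n + 1) ⁻¹' B) := h_chain.measurable _ hB
  rw [← setIntegral_congr_ae (f := Pr⟦X (n + 1) ⁻¹' B | history X n⟧)
    (h_chain.measurable k hA) ((h_chain.markov n B hB).mono fun ω h _ ↦ h),
    setIntegral_condExp (history_le h_chain n) ((integrable_const 1).indicator hB') hA',
    setIntegral_indicator hB']
  simp

variable [IsProbabilityMeasure F] [IsMarkovKernel P]

lemma measurePreserving_chain (h_inv : P.Invariant F) (h_chain : IsMarkovChain Pr X P F) (n : ℕ) :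
    MeasurePreserving (X n) Pr F := by
  refine ⟨h_chain.measurable n, ?_⟩
  induction n with
  | zero => exact h_chain.initial
  | succ n ih =>
    have := Measure.isProbabilityMeasure_map (μ := Pr) (h_chain.measurable (n + 1)).aemeasurable
    refine Measure.ext fun B hB ↦ ?_
    rw [← measureReal_eq_measureReal_iff, map_measureReal_apply (h_chain.measurable _) hB]
    have h := measureReal_inter_preimage h_chain le_rfl (n := n) MeasurableSet.univ hB
    rw [Set.preimage_univ, Set.univ_inter, setIntegral_univ] at h
    have hmeas : Measurable fun x ↦ (P x).real B := (P.measurable_coe hB).ennreal_toReal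
    rw [h, ← integral_map (h_chain.measurable n).aemeasurable
      (f := fun x ↦ (P x).real B) hmeas.aestronglyMeasurable, ih]
    simp only [measureReal_def]
    rw [integral_toReal (P.measurable_coe hB).aemeasurable (.of_forall fun x ↦ measure_lt_top _ _),
      ← Measure.bind_apply hB P.aemeasurable, h_inv.def]

/-- Both sides are continuous and bilinear in `f` and `g`, so indicators suffice, where this is the
integrated Markov property. -/
lemma inner_pullback_chain_succ (h_inv : P.Invariant F) (h_chain : IsMarkovChain Pr X P F)
    {k n : ℕ} (hk : k ≤ n) (f g : Lp ℝ 2 F) :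
    ⟪pullback (measurePreserving_chain h_inv h_chain k) f,
      pullback (measurePreserving_chain h_inv h_chain (n + 1)) g⟫_ℝ =
    ⟪pullback (measurePreserving_chain h_inv h_chain k) f,
      pullback (measurePreserving_chain h_inv h_chain n) (markovOp h_inv g)⟫_ℝ := by
  set U := pullback (measurePreserving_chain h_inv h_chain n) with hU
  set U' := pullback (measurePreserving_chain h_inv h_chain (n + 1)) with hU'
  set V := pullback (measurePreserving_chain h_inv h_chain k) with hV
  -- The adjoint of `V` turns the claim into an equality of operators, to be tested on indicators in
  -- each variable separately.
  let W := ContinuousLinearMap.adjoint V.toContinuousLinearMap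
  have hW : ∀ f g, ⟪f, W g⟫_ℝ = ⟪V f, g⟫_ℝ := fun f g ↦
    ContinuousLinearMap.adjoint_inner_right _ _ _
  suffices h : W ∘L U'.toContinuousLinearMap = W ∘L U.toContinuousLinearMap ∘L markovOp h_inv by
    rw [← hW, ← hW]
    exact congrArg (fun L ↦ ⟪f, L g⟫_ℝ) h
  refine continuousLinearMap_ext_indicator fun B hB ↦ eq_of_inner_indicatorConstLp fun A hA ↦ ?_
  simp only [ContinuousLinearMap.comp_apply, hW, LinearIsometry.coe_toContinuousLinearMap]
  rw [hV, hU', pullback_indicatorConstLp, pullback_indicatorConstLp,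
    L2.inner_indicatorConstLp_one_indicatorConstLp_one, L2.inner_indicatorConstLp_one,
    RCLike.ofReal_real_eq_id, id, measureReal_inter_preimage h_chain hk hA hB]
  refine integral_congr_ae (ae_restrict_of_ae ?_)
  filter_upwards [coeFn_pullback (measurePreserving_chain h_inv h_chain n)
      (markovOp h_inv (indicatorConstLp 2 hB (measure_ne_top F B) 1)),
    (measurePreserving_chain h_inv h_chain n).quasiMeasurePreserving.ae
      (markovOp_indicatorConstLp h_inv hB)] with ω h1 h2
  rw [h1, h2]

lemma inner_pullback_chain (h_inv : P.Invariant F) (h_chain : IsMarkovChain Pr X P F)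
    (k t : ℕ) (f g : Lp ℝ 2 F) :
    ⟪pullback (measurePreserving_chain h_inv h_chain k) f,
      pullback (measurePreserving_chain h_inv h_chain (k + t)) g⟫_ℝ =
    ⟪f, (markovOp h_inv ^ t) g⟫_ℝ := by
  induction t generalizing g with
  | zero => exact LinearIsometry.inner_map_map _ _ _
  | succ t ih =>
    rw [pow_succ, mul_apply_eq_comp, ← ih]
    exact inner_pullback_chain_succ h_inv h_chain (Nat.le_add_right k t) f g

/-- The centred version of a square integrable function. -/
noncomputable def centered (F : Measure S) [IsProbabilityMeasure F] {f : S → ℝ}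
    (hf : MemLp f 2 F) : Lp ℝ 2 F :=
  (hf.sub (memLp_const (∫ x, f x ∂F))).toLp _

lemma inner_oneLp_centered {f : S → ℝ} (hf : MemLp f 2 F) : ⟪oneLp F, centered F hf⟫_ℝ = 0 := by
  rw [inner_oneLp, centered, integral_congr_ae (MemLp.coeFn_toLp _)]
  simp only [Pi.sub_apply]
  rw [integral_sub (hf.integrable (by norm_num)) (integrable_const _)]
  simp

/-- Autocovariances of a stationary chain, in terms of the Markov operator. -/
lemma covariance_chain (h_inv : P.Invariant F) (h_chain : IsMarkovChain Pr X P F)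
    {f g : S → ℝ} (hf : MemLp f 2 F) (hg : MemLp g 2 F) (k t : ℕ) :
    cov[fun ω ↦ f (X k ω), fun ω ↦ g (X (k + t) ω); Pr] =
      ⟪centered F hf, (markovOp h_inv ^ t) (centered F hg)⟫_ℝ := by
  have hmean : ∀ n {u : S → ℝ}, MemLp u 2 F → ∫ ω, u (X n ω) ∂Pr = ∫ x, u x ∂F := by
    intro n u hu
    have hn := measurePreserving_chain h_inv h_chain n
    rw [← integral_map hn.measurable.aemeasurable (by rw [hn.map_eq]; exact hu.1), hn.map_eq]
  rw [← inner_pullback_chain h_inv h_chain k, inner_eq_integral_mul, covariance,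
    hmean k hf, hmean (k + t) hg]
  refine integral_congr_ae ?_
  simp only [centered, pullback_toLp]
  filter_upwards [MemLp.coeFn_toLp ((hf.sub (memLp_const (∫ x, f x ∂F))).comp_measurePreserving
      (measurePreserving_chain h_inv h_chain k)),
    MemLp.coeFn_toLp ((hg.sub (memLp_const (∫ x, g x ∂F))).comp_measurePreserving
      (measurePreserving_chain h_inv h_chain (k + t)))] with ω h1 h2
  rw [h1, h2]
  rfl

end Chain

end ReversibleChain

namespace ReversibleChain

/-! ### Smallest eigenvalues of symmetric matrices -/

section SmallestEigenvalue

variable {p : ℕ} {A : Matrix (Fin p) (Fin p) ℝ} {c : ℝ}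

lemma setOf_hasEigenvalue (A : Matrix (Fin p) (Fin p) ℝ) :
    {r : ℝ | Module.End.HasEigenvalue (Matrix.toLin' A) r} = spectrum ℝ A := by
  ext r
  rw [← Matrix.spectrum_toLin', ← Module.End.hasEigenvalue_iff_mem_spectrum]
  rfl

lemma exists_isSmallestEigenvalue (hp : 1 ≤ p) (hA : A.IsHermitian) :
    ∃ c, IsSmallestEigenvalue A c := by
  have : Nonempty (Fin p) := ⟨⟨0, hp⟩⟩
  obtain ⟨i, hi⟩ := Finite.exists_min hA.eigenvalues
  refine ⟨hA.eigenvalues i, ?_⟩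
  rw [IsSmallestEigenvalue, setOf_hasEigenvalue, hA.spectrum_real_eq_range_eigenvalues]
  exact ⟨⟨i, rfl⟩, by rintro _ ⟨j, rfl⟩; exact hi j⟩

/-- The Rayleigh bound: the eigenvalues of `A - c` are those of `A` shifted by `-c`, hence
nonnegative. -/
lemma IsSmallestEigenvalue.mul_dotProduct_le (hc : IsSmallestEigenvalue A c) (hA : A.IsHermitian)
    (v : Fin p → ℝ) : c * (v ⬝ᵥ v) ≤ v ⬝ᵥ (A *ᵥ v) := by
  rw [IsSmallestEigenvalue, setOf_hasEigenvalue] at hc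
  have hB : (-algebraMap ℝ (Matrix (Fin p) (Fin p) ℝ) c + A).IsHermitian := by
    rw [Algebra.algebraMap_eq_smul_one]
    refine Matrix.IsHermitian.add (Matrix.IsHermitian.neg ?_) hA
    simp [Matrix.IsHermitian]
  have hB' := hB.posSemidef_iff_eigenvalues_nonneg.2 fun i ↦ by
    have h := hc.2 (spectrum.add_mem_iff.2 (hB.eigenvalues_mem_spectrum_real i))
    simpa using h
  have h := hB'.dotProduct_mulVec_nonneg v
  simpa [Algebra.algebraMap_eq_smul_one, Matrix.add_mulVec, Matrix.neg_mulVec, Matrix.smul_mulVec,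
    dotProduct_add] using h

lemma IsSmallestEigenvalue.exists_eigenvector (hc : IsSmallestEigenvalue A c) :
    ∃ v ≠ 0, v ⬝ᵥ (A *ᵥ v) = c * (v ⬝ᵥ v) := by
  obtain ⟨v, hv⟩ := Module.End.HasEigenvalue.exists_hasEigenvector hc.1
  refine ⟨v, hv.2, ?_⟩
  have h := hv.apply_eq_smul
  rw [Matrix.toLin'_apply] at h
  rw [h, dotProduct_smul, smul_eq_mul]

lemma dotProduct_self_pos {v : Fin p → ℝ} (hv : v ≠ 0) : 0 < v ⬝ᵥ v := by
  simpa using Matrix.dotProduct_star_self_pos_iff.2 hv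

lemma IsSmallestEigenvalue.pos (hc : IsSmallestEigenvalue A c) (hA : A.PosDef) : 0 < c := by
  obtain ⟨v, hv, h⟩ := hc.exists_eigenvector
  have h1 := hA.dotProduct_mulVec_pos hv
  rw [star_trivial, h] at h1
  exact pos_of_mul_pos_left h1 (dotProduct_self_pos hv).le

/-- For an eigenvector `v` of `A` at `c`, `d * (v ⬝ᵥ v) ≤ v ⬝ᵥ (B *ᵥ v) < v ⬝ᵥ (A *ᵥ v) = c * (v ⬝ᵥ
v)`. -/
lemma IsSmallestEigenvalue.lt_of_posDef_sub {B : Matrix (Fin p) (Fin p) ℝ} {d : ℝ}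
    (hc : IsSmallestEigenvalue A c) (hd : IsSmallestEigenvalue B d) (hB : B.IsHermitian)
    (hAB : (A - B).PosDef) : d < c := by
  obtain ⟨v, hv, h⟩ := hc.exists_eigenvector
  have h1 := hAB.dotProduct_mulVec_pos hv
  rw [star_trivial, Matrix.sub_mulVec, dotProduct_sub, h] at h1
  have h2 := hd.mul_dotProduct_le hB v
  have h3 := dotProduct_self_pos hv
  exact lt_of_mul_lt_mul_right (by linarith) h3.le

lemma IsSmallestEigenvalue.le_diag (hc : IsSmallestEigenvalue A c) (hA : A.IsHermitian)
    (i : Fin p) : c ≤ A i i := by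
  simpa using hc.mul_dotProduct_le hA (Pi.single i 1)

end SmallestEigenvalue

/-! ### Autocovariance matrices as quadratic forms of the Markov operator -/

section Autocovariance

open scoped InnerProductSpace

variable {S Ω : Type*} [MeasurableSpace S] [MeasurableSpace Ω] {F : Measure S}
  [IsProbabilityMeasure F] {P : Kernel S S} [IsMarkovKernel P] {Pr : Measure Ω}
  [IsProbabilityMeasure Pr] {X : ℕ → Ω → S} {p : ℕ} {g : S → Fin p → ℝ}

lemma crossCov_apply (h_inv : P.Invariant F) (h_chain : IsMarkovChain Pr X P F)
    (h_sq : ∀ a, MemLp (fun x ↦ g x a) 2 F) (k t : ℕ) (a b : Fin p) :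
    crossCov Pr X g k (k + t) a b =
      ⟪centered F (h_sq a), (markovOp h_inv ^ t) (centered F (h_sq b))⟫_ℝ :=
  covariance_chain h_inv h_chain (h_sq a) (h_sq b) k t

lemma autocov_apply (h_inv : P.Invariant F) (h_chain : IsMarkovChain Pr X P F)
    (h_sq : ∀ a, MemLp (fun x ↦ g x a) 2 F) (t : ℕ) (a b : Fin p) :
    autocov Pr X g t a b =
      ⟪centered F (h_sq a), (markovOp h_inv ^ t) (centered F (h_sq b))⟫_ℝ := by
  rw [← crossCov_apply h_inv h_chain h_sq 0 t, zero_add, autocov]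

lemma dotProduct_autocov_mulVec (h_inv : P.Invariant F) (h_chain : IsMarkovChain Pr X P F)
    (h_sq : ∀ a, MemLp (fun x ↦ g x a) 2 F) (t : ℕ) (v : Fin p → ℝ) :
    v ⬝ᵥ (autocov Pr X g t *ᵥ v) =
      ⟪∑ a, v a • centered F (h_sq a), (markovOp h_inv ^ t) (∑ a, v a • centered F (h_sq a))⟫_ℝ := by
  simp only [dotProduct, Matrix.mulVec, autocov_apply h_inv h_chain h_sq, map_sum, map_smul,
    sum_inner, inner_sum, real_inner_smul_left, real_inner_smul_right, Finset.mul_sum]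
  rw [Finset.sum_comm]
  exact Finset.sum_congr rfl fun a _ ↦ Finset.sum_congr rfl fun b _ ↦ by ring

lemma covariance_dotProduct (h_inv : P.Invariant F) (h_chain : IsMarkovChain Pr X P F)
    (h_sq : ∀ a, MemLp (fun x ↦ g x a) 2 F) (t : ℕ) (v : Fin p → ℝ) :
    cov[fun ω ↦ v ⬝ᵥ g (X 0 ω), fun ω ↦ v ⬝ᵥ g (X t ω); Pr] = v ⬝ᵥ (autocov Pr X g t *ᵥ v) := by
  have hL : ∀ n a, MemLp (fun ω ↦ v a * g (X n ω) a) 2 Pr := fun n a ↦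
    ((h_sq a).comp_measurePreserving (measurePreserving_chain h_inv h_chain n)).const_mul (v a)
  simp only [dotProduct]
  rw [covariance_fun_sum_fun_sum (hL 0) (hL t)]
  simp only [covariance_const_mul_left, covariance_const_mul_right, Matrix.mulVec, dotProduct,
    autocov, crossCov, Matrix.of_apply, Finset.mul_sum]
  exact Finset.sum_congr rfl fun a _ ↦ Finset.sum_congr rfl fun b _ ↦ by ring

lemma isHermitian_autocov (h_rev : P.IsReversible F) (h_chain : IsMarkovChain Pr X P F)
    (h_sq : ∀ a, MemLp (fun x ↦ g x a) 2 F) (t : ℕ) : (autocov Pr X g t).IsHermitian := by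
  refine Matrix.IsHermitian.ext fun a b ↦ ?_
  rw [star_trivial, autocov_apply h_rev.invariant h_chain h_sq,
    autocov_apply h_rev.invariant h_chain h_sq, real_inner_comm,
    inner_pow_left (markovOp_symm h_rev)]

lemma isHermitian_pairSum (h_rev : P.IsReversible F) (h_chain : IsMarkovChain Pr X P F)
    (h_sq : ∀ a, MemLp (fun x ↦ g x a) 2 F) (i : ℕ) : (pairSum Pr X g i).IsHermitian :=
  (isHermitian_autocov h_rev h_chain h_sq _).add (isHermitian_autocov h_rev h_chain h_sq _)

lemma inner_oneLp_sum_centered (h_sq : ∀ a, MemLp (fun x ↦ g x a) 2 F) (v : Fin p → ℝ) :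
    ⟪oneLp F, ∑ a, v a • centered F (h_sq a)⟫_ℝ = 0 := by
  simp only [inner_sum, real_inner_smul_right, inner_oneLp_centered, mul_zero,
    Finset.sum_const_zero]

/-- If the operator killed this vector, every covariance at lag `t ≥ 1` would vanish. -/
lemma markovOp_sum_centered_ne_zero (h_inv : P.Invariant F) (h_chain : IsMarkovChain Pr X P F)
    (h_sq : ∀ a, MemLp (fun x ↦ g x a) 2 F) {v : Fin p → ℝ}
    (hv : ∃ t : ℕ, 1 ≤ t ∧ cov[fun ω ↦ v ⬝ᵥ g (X 0 ω), fun ω ↦ v ⬝ᵥ g (X t ω); Pr] ≠ 0) :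
    markovOp h_inv (∑ a, v a • centered F (h_sq a)) ≠ 0 := by
  obtain ⟨t, ht, hcov⟩ := hv
  intro h
  obtain ⟨s, rfl⟩ := Nat.exists_eq_add_of_le' ht
  apply hcov
  rw [covariance_dotProduct h_inv h_chain h_sq, dotProduct_autocov_mulVec h_inv h_chain h_sq,
    pow_succ, mul_apply_eq_comp, h, map_zero, inner_zero_right]

end Autocovariance

end ReversibleChain

theorem proposition1
    {S Ω : Type*} [MeasurableSpace S] [MeasurableSpace Ω]
    -- the target distribution and the transition kernel
    (F : Measure S) [IsProbabilityMeasure F]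
    (P : Kernel S S) [IsMarkovKernel P]
    (h_reversible : P.IsReversible F)
    (φ : Measure S) [SigmaFinite φ] (h_phi : φ ≠ 0)
    (h_irreducible : Kernel.IsIrreducible φ P)
    (h_aperiodic : ReversibleChain.IsAperiodic P F)
    -- the stationary chain
    (Pr : Measure Ω) [IsProbabilityMeasure Pr] (X : ℕ → Ω → S)
    (h_chain : ReversibleChain.IsMarkovChain Pr X P F)
    -- the function of interest, square integrable with respect to `F`
    (p : ℕ) (h_p : 1 ≤ p) (g : S → Fin p → ℝ)
    (h_sq : ∀ a, MemLp (fun x => g x a) 2 F)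
    -- no nontrivial linear combination of the coordinates of `g` is uncorrelated along the chain
    (h_nontrivial : ∀ v : Fin p → ℝ, v ≠ 0 → ∃ t : ℕ, 1 ≤ t ∧
      cov[fun ω => v ⬝ᵥ g (X 0 ω), fun ω => v ⬝ᵥ g (X t ω); Pr] ≠ 0) :
    -- the autocovariances do not depend on the base time
    (∀ k t : ℕ, ReversibleChain.crossCov Pr X g k (k + t) = ReversibleChain.autocov Pr X g t) ∧
    (∀ i : ℕ, (ReversibleChain.pairSum Pr X g i).PosDef) ∧
    (∀ i : ℕ, (ReversibleChain.pairSum Pr X g i - ReversibleChain.pairSum Pr X g (i + 1)).PosDef) ∧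
    Tendsto (fun i : ℕ => ReversibleChain.pairSum Pr X g i) atTop (𝓝 0) ∧
    ∃ ξ : ℕ → ℝ,
      (∀ i : ℕ, ReversibleChain.IsSmallestEigenvalue (ReversibleChain.pairSum Pr X g i) (ξ i)) ∧
      (∀ i : ℕ, 0 < ξ i) ∧ StrictAnti ξ ∧ Tendsto ξ atTop (𝓝 0) := by
  have h_inv := h_reversible.invariant
  have hT := ReversibleChain.markovOp_symm h_reversible
  have hc := ReversibleChain.norm_markovOp_le h_inv
  have h1 := ReversibleChain.markovOp_oneLp h_inv
  have hfix : ∀ f, inner ℝ (ReversibleChain.oneLp F) f = 0 →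
      ReversibleChain.markovOp h_inv f = f → f = 0 :=
    fun f ↦ ReversibleChain.eq_zero_of_markovOp_eq h_phi h_irreducible
  have hneg : ∀ f, ReversibleChain.markovOp h_inv f = -f → f = 0 :=
    fun f ↦ ReversibleChain.eq_zero_of_markovOp_eq_neg h_aperiodic
  have hherm := ReversibleChain.isHermitian_pairSum h_reversible h_chain h_sq
  have hpos : ∀ i, (ReversibleChain.pairSum Pr X g i).PosDef := by
    refine fun i ↦ Matrix.PosDef.of_dotProduct_mulVec_pos (hherm i) fun v hv ↦ ?_
    rw [star_trivial, ReversibleChain.pairSum, Matrix.add_mulVec, dotProduct_add,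
      ReversibleChain.dotProduct_autocov_mulVec h_inv h_chain h_sq,
      ReversibleChain.dotProduct_autocov_mulVec h_inv h_chain h_sq]
    exact ReversibleChain.inner_pow_pair_pos hT hc hneg
      (ReversibleChain.markovOp_sum_centered_ne_zero h_inv h_chain h_sq (h_nontrivial v hv)) i
  have hsub : ∀ i, (ReversibleChain.pairSum Pr X g i -
      ReversibleChain.pairSum Pr X g (i + 1)).PosDef := by
    refine fun i ↦ Matrix.PosDef.of_dotProduct_mulVec_pos ((hherm i).sub (hherm (i + 1)))
      fun v hv ↦ ?_
    rw [star_trivial, Matrix.sub_mulVec, dotProduct_sub, ReversibleChain.pairSum,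
      ReversibleChain.pairSum, Matrix.add_mulVec, dotProduct_add, Matrix.add_mulVec, dotProduct_add]
    simp only [ReversibleChain.dotProduct_autocov_mulVec h_inv h_chain h_sq]
    exact ReversibleChain.inner_pow_pair_sub_pos hT hc h1 hfix hneg
      (ReversibleChain.inner_oneLp_sum_centered h_sq v)
      (ReversibleChain.markovOp_sum_centered_ne_zero h_inv h_chain h_sq (h_nontrivial v hv)) i
  have hcov : Tendsto (ReversibleChain.autocov Pr X g) atTop (𝓝 0) := by
    refine tendsto_pi_nhds.2 fun a ↦ tendsto_pi_nhds.2 fun b ↦ ?_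
    simp only [ReversibleChain.autocov_apply h_inv h_chain h_sq]
    have h := tendsto_const_nhds (x := ReversibleChain.centered F (h_sq a)) |>.inner (𝕜 := ℝ)
      (ReversibleChain.tendsto_pow_apply_zero hT hc h1 hfix hneg
        (ReversibleChain.inner_oneLp_centered (h_sq b)))
    rwa [inner_zero_right] at h
  have hlim : Tendsto (fun i ↦ ReversibleChain.pairSum Pr X g i) atTop (𝓝 0) := by
    have h2 : Tendsto (fun i : ℕ ↦ 2 * i) atTop atTop :=
      tendsto_id.const_mul_atTop' two_pos
    have h := (hcov.comp h2).add (hcov.comp ((tendsto_add_atTop_nat 1).comp h2))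
    rwa [add_zero] at h
  choose ξ hξ using fun i ↦ ReversibleChain.exists_isSmallestEigenvalue h_p (hherm i)
  have hξ_pos : ∀ i, 0 < ξ i := fun i ↦ (hξ i).pos (hpos i)
  refine ⟨fun k t ↦ ?_, hpos, hsub, hlim, ξ, hξ, hξ_pos,
    strictAnti_nat_of_succ_lt fun i ↦
      (hξ i).lt_of_posDef_sub (hξ (i + 1)) (hherm (i + 1)) (hsub i), ?_⟩
  · ext a b
    rw [ReversibleChain.crossCov_apply h_inv h_chain h_sq,
      ReversibleChain.autocov_apply h_inv h_chain h_sq]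
  -- The smallest eigenvalue is squeezed between `0` and the first diagonal entry of `Γ_i`, which
  -- exists because `1 ≤ p`.
  · have hdiag := tendsto_pi_nhds.1 (tendsto_pi_nhds.1 hlim ⟨0, h_p⟩) ⟨0, h_p⟩
    exact squeeze_zero (fun i ↦ (hξ_pos i).le) (fun i ↦ (hξ i).le_diag (hherm i) _) hdiag
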